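/- All digraphs are finite and simple (no loops, no multiple arcs). For a digraph $D$ on $n$ vertices let $A(D)$ be its adjacency matrix, let $\operatorname{diag}(D)$ be the diagonal matrix of its outdegrees, and let $q(D)$ be the signless Laplacian spectral radius of $D$, i.e. the largest modulus of an eigenvalue of $Q(D)=\operatorname{diag}(D)+A(D)$. For integers $a,b,c\ge 0$, not $a=b=0$, let $\theta(a,b,c)$ be the digraph on $a+b+c+2$ vertices consisting of two distinct vertices $s,t$ and three directed paths without common inner vertices: two from $s$ to $t$, with $a$ and $b$ inner vertices respectively, and one from $t$ to $s$, with $c$ inner vertices. Let $\overrightarrow{C_n}$ be the directed cycle on $n$ vertices. **Theorem 5.4.** Let $n\ge 4$. Then, up to isomorphism, $\overrightarrow{C_n}$, $\theta(0,1,n-3)$, $\theta(1,1,n-4)$ and $\theta(0,2,n-4)$ are the unique digraphs attaining, respectively, the smallest, the second smallest, the third smallest and the fourth smallest value of $q$ among all strongly connected digraphs on $n$ vertices. Here $H$ is said to attain the $k$-th smallest value of $q$ if exactly $k-1$ distinct values of $q$ on strongly connected digraphs with $n$ vertices are smaller than $q(H)$, and $H$ is the unique such digraph if every strongly connected digraph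 $D$ on $n$ vertices with $q(D)=q(H)$ is isomorphic to $H$. -/

import Mathlib

namespace StrongDigraph

/-- Digraphs are Mathlib's `Digraph` (a relation on the vertices, so there are no multiple arcs);
a digraph is simple if moreover it has no loops. -/
def IsSimple {V : Type*} (D : Digraph V) : Prop :=
  ∀ v, ¬ D.Adj v v

/-- From every vertex there is a directed path (equivalently walk) to every vertex. -/
def IsStronglyConnected {V : Type*} (D : Digraph V) : Prop :=
  ∀ u v, Relation.ReflTransGen D.Adj u v

/-- Isomorphism of digraphs. -/
def IsIso {V W : Type*} (D : Digraph V) (H : Digraph W) : Prop :=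
  Nonempty (D.Adj ≃r H.Adj)

open Classical in
/-- The number of out-neighbours of `v`. -/
noncomputable def outDegree {V : Type*} [Fintype V] (D : Digraph V) (v : V) : ℕ :=
  (Finset.univ.filter fun w => D.Adj v w).card

open Classical in
/-- The adjacency matrix, with complex entries, so that its eigenvalues may be complex. -/
noncomputable def adjMatrix {V : Type*} (D : Digraph V) : Matrix V V ℂ :=
  Matrix.of fun v w => if D.Adj v w then 1 else 0

open Classical in
/-- The signless Laplacian matrix: diagonal matrix of outdegrees plus adjacency matrix. -/
noncomputable def signlessLaplacian {V : Type*} [Fintype V] (D : Digraph V) : Matrix V V ℂ :=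
  Matrix.diagonal (fun v => (outDegree D v : ℂ)) + adjMatrix D

open Classical in
/-- The signless Laplacian spectral radius `q(D)`: the largest modulus of a complex eigenvalue of
the signless Laplacian matrix. (Mathlib's `spectralRadius` takes values in `ℝ≥0∞`; here it is
finite, because a square matrix has finitely many eigenvalues.) -/
noncomputable def q {V : Type*} [Fintype V] (D : Digraph V) : ℝ :=
  (spectralRadius ℂ (signlessLaplacian D)).toReal

/-- The directed cycle `0 → 1 → ⋯ → n - 1 → 0`. -/
def directedCycle (n : ℕ) : Digraph (Fin n) where
  Adj i j := (i.val + 1) % n = j.val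

/-- The vertices of the theta digraph: two hubs (`false` and `true`), and the `a`, `b` and `c`
inner vertices of the three paths. -/
abbrev ThetaVertex (a b c : ℕ) : Type :=
  Bool ⊕ (Fin a ⊕ (Fin b ⊕ Fin c))

/-- The `i`-th vertex (`0 ≤ i ≤ m + 1`) of the directed path on `m + 2` vertices with initial
vertex `s`, inner vertices `f 0, …, f (m - 1)` and terminal vertex `t`. -/
def pathVertex {V : Type*} {m : ℕ} (s : V) (f : Fin m → V) (t : V) (i : ℕ) : V :=
  if i = 0 then s else if h : i - 1 < m then f ⟨i - 1, h⟩ else t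

/-- `(x, y)` is an arc of the directed path `s → f 0 → ⋯ → f (m - 1) → t` on `m + 2` vertices. -/
def PathArc {V : Type*} {m : ℕ} (s : V) (f : Fin m → V) (t : V) (x y : V) : Prop :=
  ∃ i ≤ m, x = pathVertex s f t i ∧ y = pathVertex s f t (i + 1)

/-- The digraph `θ(a, b, c)`: two directed paths on `a + 2` and `b + 2` vertices from the hub
`false` to the hub `true` and a directed path on `c + 2` vertices from the hub `true` back to the
hub `false`, without common inner vertices. -/
def theta (a b c : ℕ) : Digraph (ThetaVertex a b c) where
  Adj x y :=
    PathArc (Sum.inl false) (fun i : Fin a => Sum.inr (Sum.inl i)) (Sum.inl true) x y ∨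
    PathArc (Sum.inl false) (fun i : Fin b => Sum.inr (Sum.inr (Sum.inl i))) (Sum.inl true) x y ∨
    PathArc (Sum.inl true) (fun i : Fin c => Sum.inr (Sum.inr (Sum.inr i))) (Sum.inl false) x y

/-- `H` is, up to isomorphism, the unique digraph attaining the `k`-th smallest (`k ≥ 1`) signless
Laplacian spectral radius among all simple strongly connected digraphs on `n` vertices: `H` is such
a digraph, exactly `k - 1` distinct values of `q` on such digraphs are smaller than `q(H)`, and
every such digraph `D` with `q(D) = q(H)` is isomorphic to `H`. -/
def IsUniqueKthMinimizer (n k : ℕ) {W : Type*} [Fintype W] (H : Digraph W) : Prop :=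
  Fintype.card W = n ∧ IsSimple H ∧ IsStronglyConnected H ∧
  {x : ℝ | x < q H ∧
    ∃ D : Digraph (Fin n), IsSimple D ∧ IsStronglyConnected D ∧ q D = x}.encard + 1 = k ∧
  ∀ D : Digraph (Fin n), IsSimple D → IsStronglyConnected D → q D = q H → IsIso D H

end StrongDigraph

/-!
The proof compares `q` with positive test vectors. If a positive vector `x` satisfies `Q x ≥ r x`,
then `q ≥ r` by Gelfand's formula (`le_q_of_le_signlessAct`), and if `Q x = r x`, then `q = r`
(`q_eq_of_signlessAct_eq`).

Let `S` be the set of vertices of outdegree at least `2` and let `d v` be the distance from `v` to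
`S`. For `μ > 0` the vector `x v = μ ^ (-d v)` satisfies `Q x ≥ (1 + μ) x` off `S`, because some
out-neighbour of `v` is one step nearer to `S`. At a vertex `s` of `S` with out-neighbours
`w₁ ≠ w₂` the same inequality follows from `μ - 1 ≤ μ ^ (-d w₁) + μ ^ (-d w₂)`, and if this is
strict throughout `S`, then `q > 1 + μ` (`IsLevelFunction.lt_q`). If `S = {s}` and `s` has
outdegree `2`, then `x` is an eigenvector for `q = 1 + μ`, where `μ` solves the corresponding
equation. In particular, with `n` the number of vertices,
`q (θ(a, b, c)) = 1 + μ` with `μ - 1 = μ ^ (a - n + 1) + μ ^ (b - n + 1)` (`q_theta`), so the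
inequalities `1 + μ < 2 μ < 1 + μ ^ 2` for `μ > 1` order the three theta digraphs of the theorem.

Now let `μ` belong to `θ(0, 2, n - 4)`, that is, `μ - 1 = μ ^ (-(n - 1)) + μ ^ (-(n - 3))`;
then `μ < 2`. For any strongly connected digraph on `n` vertices (`isIso_or_lt_q`):
* if `S` is empty, the digraph is a directed cycle, and `q = 2`;
* if `S` has at least two elements, all distances are at most `n - 2`, and two different vertices
  cannot both be at distance `n - 2`, so `q > 1 + μ`, since `μ + μ ^ 2 > 1 + μ ^ 2`;
* if `S = {s}` and `s` has outdegree at least `3`, then `Q x ≥ (1 + μ) x` is strict at `s` already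
  because `3 > 1 + μ`;
* if `S = {s}` and `s` has the two out-neighbours `w₁`, `w₂`, then `q > 1 + μ` unless the distances
  `d w₁`, `d w₂` are `n - 1, n - 2` or `n - 2, n - 2` or `n - 1, n - 3`. In these three cases the
  distances leave no freedom: the levels (almost) enumerate the vertices, and the digraph is one of
  the three theta digraphs.
-/

namespace StrongDigraph

/-! ### The signless Laplacian and positive test vectors -/

section Spectral

variable {V : Type*} [Fintype V]

open Classical in
/-- The signless Laplacian of `D` acting on real vectors. -/
noncomputable def signlessAct (D : Digraph V) (x : V → ℝ) (v : V) : ℝ :=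
  outDegree D v * x v + ∑ w with D.Adj v w, x w

lemma signlessAct_mono (D : Digraph V) {x y : V → ℝ} (h : ∀ v, x v ≤ y v) (v : V) :
    signlessAct D x v ≤ signlessAct D y v := by
  unfold signlessAct
  gcongr
  · exact h v
  · exact h _

lemma signlessAct_const_mul (D : Digraph V) (c : ℝ) (x : V → ℝ) (v : V) :
    signlessAct D (fun w => c * x w) v = c * signlessAct D x v := by
  simp only [signlessAct, mul_add, Finset.mul_sum]
  ring

open Classical in
lemma signlessLaplacian_mulVec_apply (D : Digraph V) (y : V → ℂ) (v : V) :
    (signlessLaplacian D).mulVec y v = outDegree D v * y v + ∑ w with D.Adj v w, y w := by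
  rw [signlessLaplacian, Matrix.add_mulVec, Pi.add_apply, Matrix.mulVec_diagonal]
  simp [adjMatrix, Matrix.mulVec, dotProduct, Finset.sum_filter]

lemma signlessLaplacian_mulVec_ofReal (D : Digraph V) (x : V → ℝ) :
    (signlessLaplacian D).mulVec (fun v => (x v : ℂ)) = fun v => (signlessAct D x v : ℂ) := by
  funext v
  simp [signlessLaplacian_mulVec_apply, signlessAct]

open Classical in
lemma signlessLaplacian_pow_mulVec_ofReal (D : Digraph V) (x : V → ℝ) (k : ℕ) :
    (signlessLaplacian D ^ k).mulVec (fun v => (x v : ℂ)) =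
      fun v => (((signlessAct D)^[k] x) v : ℂ) := by
  induction k with
  | zero => simp
  | succ k ih =>
    rw [pow_succ', ← Matrix.mulVec_mulVec, ih, signlessLaplacian_mulVec_ofReal,
      Function.iterate_succ_apply']

lemma pow_mul_le_iterate_signlessAct (D : Digraph V) {x : V → ℝ} {r : ℝ} (hr : 0 ≤ r)
    (h : ∀ v, r * x v ≤ signlessAct D x v) (k : ℕ) (v : V) :
    r ^ k * x v ≤ ((signlessAct D)^[k] x) v := by
  induction k generalizing v with
  | zero => simp
  | succ k ih =>
    rw [Function.iterate_succ_apply']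
    calc r ^ (k + 1) * x v = r ^ k * (r * x v) := by ring
      _ ≤ r ^ k * signlessAct D x v := by gcongr; exact h v
      _ = signlessAct D (fun w => r ^ k * x w) v := (signlessAct_const_mul D _ x v).symm
      _ ≤ _ := signlessAct_mono D ih v

open Classical in
lemma spectralRadius_signlessLaplacian_ne_top (D : Digraph V) :
    spectralRadius ℂ (signlessLaplacian D) ≠ ⊤ := by
  let _ : NormedRing (Matrix V V ℂ) := Matrix.linftyOpNormedRing
  let _ : NormedAlgebra ℂ (Matrix V V ℂ) := Matrix.linftyOpNormedAlgebra
  have : CompleteSpace (Matrix V V ℂ) := FiniteDimensional.complete ℂ _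
  rcases isEmpty_or_nonempty V with hV | hV
  · simp [spectrum.SpectralRadius.of_subsingleton]
  · exact ne_top_of_le_ne_top ENNReal.coe_ne_top (spectrum.spectralRadius_le_nnnorm _)

open Classical in
/-- A positive vector `x` with `Q x ≥ r x` bounds the spectral radius from below, since then
`Q ^ k x ≥ r ^ k x` and hence `‖Q ^ k‖ ≥ r ^ k` for all `k`. -/
lemma le_q_of_le_signlessAct [Nonempty V] (D : Digraph V) {x : V → ℝ} {r : ℝ} (hr : 0 ≤ r)
    (hx : ∀ v, 0 < x v) (h : ∀ v, r * x v ≤ signlessAct D x v) : r ≤ q D := by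
  let _ : NormedRing (Matrix V V ℂ) := Matrix.linftyOpNormedRing
  let _ : NormedAlgebra ℂ (Matrix V V ℂ) := Matrix.linftyOpNormedAlgebra
  have : CompleteSpace (Matrix V V ℂ) := FiniteDimensional.complete ℂ _
  obtain ⟨v, hv⟩ := Finite.exists_max x
  have hnorm : ‖fun w => (x w : ℂ)‖ = x v := by
    apply le_antisymm
    · refine (pi_norm_le_iff_of_nonneg (hx v).le).2 fun w => ?_
      simpa [abs_of_pos (hx w)] using hv w
    · simpa [abs_of_pos (hx v)] using norm_le_pi_norm (fun w => (x w : ℂ)) v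
  have hpow (k : ℕ) : r ^ k ≤ ‖signlessLaplacian D ^ k‖ := by
    have h1 := Matrix.linfty_opNorm_mulVec (signlessLaplacian D ^ k) (fun w => (x w : ℂ))
    rw [signlessLaplacian_pow_mulVec_ofReal, hnorm] at h1
    have h2 := norm_le_pi_norm (fun w => (((signlessAct D)^[k] x) w : ℂ)) v
    have h3 := pow_mul_le_iterate_signlessAct D hr h k v
    have h4 : ((signlessAct D)^[k] x) v ≤ ‖(((signlessAct D)^[k] x) v : ℂ)‖ := by
      simpa using le_abs_self _
    exact le_of_mul_le_mul_right (h3.trans (h4.trans (h2.trans h1))) (hx v)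
  have hlim := spectrum.pow_norm_pow_one_div_tendsto_nhds_spectralRadius (signlessLaplacian D)
  have hle : ENNReal.ofReal r ≤ spectralRadius ℂ (signlessLaplacian D) := by
    refine ge_of_tendsto hlim ?_
    filter_upwards [Filter.eventually_gt_atTop 0] with k hk
    refine ENNReal.ofReal_le_ofReal ?_
    calc r = (r ^ k) ^ (1 / k : ℝ) := by
          rw [one_div, Real.pow_rpow_inv_natCast hr hk.ne']
      _ ≤ _ := by gcongr; exact hpow k
  exact (ENNReal.ofReal_le_iff_le_toReal (spectralRadius_signlessLaplacian_ne_top D)).1 hle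

open Classical in
/-- A positive vector `x` with `Q x ≤ r x` bounds every eigenvalue: compare the moduli of the
entries of an eigenvector `y` with `x` at a vertex where `|y| / x` is largest. -/
lemma q_le_of_signlessAct_le (D : Digraph V) {x : V → ℝ} {r : ℝ} (hr : 0 ≤ r)
    (hx : ∀ v, 0 < x v) (h : ∀ v, signlessAct D x v ≤ r * x v) : q D ≤ r := by
  have key : spectralRadius ℂ (signlessLaplacian D) ≤ ENNReal.ofReal r := by
    refine iSup₂_le fun z hz => ?_
    rw [← Matrix.spectrum_toLin', ← Module.End.hasEigenvalue_iff_mem_spectrum] at hz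
    obtain ⟨y, hy⟩ := hz.exists_hasEigenvector
    have hy0 := hy.2
    have hyz : (signlessLaplacian D).mulVec y = z • y := by
      simpa using hy.apply_eq_smul
    obtain ⟨u, hu⟩ := Function.ne_iff.1 hy0
    have : Nonempty V := ⟨u⟩
    obtain ⟨v, hv⟩ := Finite.exists_max fun w => ‖y w‖ / x w
    have hw (w : V) : ‖y w‖ ≤ ‖y v‖ / x v * x w := (div_le_iff₀ (hx w)).1 (hv w)
    have hpos : 0 < ‖y v‖ := by
      have h1 : 0 < ‖y u‖ / x u := div_pos (norm_pos_iff.2 hu) (hx u)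
      have h2 := mul_pos (h1.trans_le (hv u)) (hx v)
      rwa [div_mul_cancel₀ _ (hx v).ne'] at h2
    have h1 : ‖z‖ * ‖y v‖ ≤ r * ‖y v‖ := by
      calc ‖z‖ * ‖y v‖ = ‖(signlessLaplacian D).mulVec y v‖ := by rw [hyz]; simp
        _ ≤ signlessAct D (fun w => ‖y w‖) v := by
          rw [signlessLaplacian_mulVec_apply]
          refine (norm_add_le _ _).trans ?_
          unfold signlessAct
          gcongr
          · simp
          · exact norm_sum_le _ _
        _ ≤ signlessAct D (fun w => ‖y v‖ / x v * x w) v := signlessAct_mono D hw v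
        _ = ‖y v‖ / x v * signlessAct D x v := signlessAct_const_mul D _ x v
        _ ≤ ‖y v‖ / x v * (r * x v) := by
          gcongr
          · exact div_nonneg hpos.le (hx v).le
          · exact h v
        _ = r * ‖y v‖ := by field_simp [(hx v).ne']
    rw [← enorm_eq_nnnorm, ← ofReal_norm]
    exact ENNReal.ofReal_le_ofReal (le_of_mul_le_mul_right h1 hpos)
  exact ENNReal.toReal_le_of_le_ofReal hr key

lemma q_eq_of_signlessAct_eq [Nonempty V] (D : Digraph V) {x : V → ℝ} {r : ℝ} (hr : 0 ≤ r)
    (hx : ∀ v, 0 < x v) (h : ∀ v, signlessAct D x v = r * x v) : q D = r :=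
  le_antisymm (q_le_of_signlessAct_le D hr hx fun v => (h v).le)
    (le_q_of_le_signlessAct D hr hx fun v => (h v).ge)

end Spectral

/-! ### Invariance under isomorphism -/

section Iso

variable {V W : Type*}

lemma outDegree_eq_of_relIso [Fintype V] [Fintype W] {D : Digraph V} {H : Digraph W}
    (e : D.Adj ≃r H.Adj) (v : V) : outDegree H (e v) = outDegree D v := by
  classical
  unfold outDegree
  refine (Finset.card_bij (fun w _ => e w) ?_ ?_ ?_).symm
  · intro w hw
    simpa [e.map_rel_iff] using hw
  · intro w₁ _ w₂ _ h
    exact e.injective h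
  · intro w hw
    refine ⟨e.symm w, ?_, by simp⟩
    have : H.Adj (e v) (e (e.symm w)) := by simpa using hw
    simpa using e.map_rel_iff.1 this

lemma IsIso.q_eq [Fintype V] [Fintype W] {D : Digraph V} {H : Digraph W} (h : IsIso D H) :
    q D = q H := by
  classical
  obtain ⟨e⟩ := h
  have hQ : signlessLaplacian D =
      Matrix.reindexAlgEquiv ℂ ℂ e.symm.toEquiv (signlessLaplacian H) := by
    ext v w
    have he : e.symm.toEquiv.symm = e.toEquiv := rfl
    have hcoe (u : V) : e.toEquiv u = e u := rfl
    have hdeg := outDegree_eq_of_relIso e v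
    have hadj := e.map_rel_iff (a := v) (b := w)
    simp only [signlessLaplacian, adjMatrix, Matrix.diagonal_apply, Matrix.coe_reindexAlgEquiv,
      Matrix.reindex_apply, Matrix.submatrix_apply, Matrix.add_apply, Matrix.of_apply, he,
      hcoe, hdeg, hadj, e.injective.eq_iff]
  have hs : spectrum ℂ (signlessLaplacian D) = spectrum ℂ (signlessLaplacian H) := by
    rw [hQ, AlgEquiv.spectrum_eq]
  unfold q spectralRadius
  rw [hs]

lemma IsIso.isSimple {D : Digraph V} {H : Digraph W} (h : IsIso D H) (hD : IsSimple D) :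
    IsSimple H := by
  obtain ⟨e⟩ := h
  intro w hw
  exact hD _ (e.symm.map_rel_iff.2 hw)

lemma IsIso.isStronglyConnected {D : Digraph V} {H : Digraph W} (h : IsIso D H)
    (hD : IsStronglyConnected D) : IsStronglyConnected H := by
  obtain ⟨e⟩ := h
  intro u v
  have := Relation.ReflTransGen.lift (p := H.Adj) e (fun _ _ h => e.map_rel_iff.2 h) _ _
    (hD (e.symm u) (e.symm v))
  simpa [Function.onFun] using this

/-- Two digraphs on `n` vertices are isomorphic if their vertices can be labelled by
`0, …, n - 1` such that the arcs are described by the same relation between labels. -/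
lemma isIso_of_labels [Fintype V] [Fintype W] {D : Digraph V} {H : Digraph W} {n : ℕ}
    {R : ℕ → ℕ → Prop} {L : V → ℕ} {M : W → ℕ}
    (hV : Fintype.card V = n) (hW : Fintype.card W = n)
    (hL : Function.Injective L) (hM : Function.Injective M)
    (hLn : ∀ v, L v < n) (hMn : ∀ w, M w < n)
    (hD : ∀ x y, D.Adj x y ↔ R (L x) (L y)) (hH : ∀ x y, H.Adj x y ↔ R (M x) (M y)) :
    IsIso D H := by
  have bL : Function.Bijective fun v => (⟨L v, hLn v⟩ : Fin n) :=
    (Fintype.bijective_iff_injective_and_card _).2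
      ⟨fun a b h => hL (Fin.mk.inj_iff.1 h), by simp [hV]⟩
  have bM : Function.Bijective fun w => (⟨M w, hMn w⟩ : Fin n) :=
    (Fintype.bijective_iff_injective_and_card _).2
      ⟨fun a b h => hM (Fin.mk.inj_iff.1 h), by simp [hW]⟩
  let e : V ≃ W := (Equiv.ofBijective _ bL).trans (Equiv.ofBijective _ bM).symm
  have he (v : V) : M (e v) = L v := by
    have := (Equiv.ofBijective _ bM).apply_symm_apply (Equiv.ofBijective _ bL v)
    exact Fin.mk.inj_iff.1 this
  exact ⟨⟨e, fun {a b} => by rw [hH, hD, he, he]⟩⟩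

end Iso

/-! ### Level functions -/

section Level

variable {V : Type*}

/-- `d` behaves like the distance to the set `S`: it vanishes exactly on `S`, and every other vertex
has an out-neighbour one level further down. Minimality of `d` is not required. -/
structure IsLevelFunction (D : Digraph V) (S : Finset V) (d : V → ℕ) : Prop where
  eq_zero_iff : ∀ v, d v = 0 ↔ v ∈ S
  exists_adj : ∀ v ∉ S, ∃ w, D.Adj v w ∧ d w + 1 = d v

lemma exists_isLevelFunction {D : Digraph V} (hD : IsStronglyConnected D) {S : Finset V}
    (hS : S.Nonempty) : ∃ d, IsLevelFunction D S d := by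
  classical
  -- `P k v`: some walk of length `k` leads from `v` to `S`
  let P : ℕ → V → Prop := fun k =>
    Nat.rec (motive := fun _ => V → Prop) (· ∈ S) (fun _ p v => ∃ w, D.Adj v w ∧ p w) k
  have hP : ∀ v, ∃ k, P k v := by
    obtain ⟨s, hs⟩ := hS
    intro v
    induction hD v s using Relation.ReflTransGen.head_induction_on with
    | refl => exact ⟨0, hs⟩
    | head hab _ ih =>
      obtain ⟨k, hk⟩ := ih
      exact ⟨k + 1, _, hab, hk⟩
  let d : V → ℕ := fun v => Nat.find (hP v)
  have hspec (v : V) : P (d v) v := Nat.find_spec (hP v)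
  have hmin (v : V) {k : ℕ} (hk : P k v) : d v ≤ k := Nat.find_min' (hP v) hk
  refine ⟨d, fun v => ⟨fun h0 => ?_, fun hv => Nat.le_zero.1 (hmin v (k := 0) hv)⟩, fun v hv => ?_⟩
  · have := hspec v
    rwa [h0] at this
  · have h1 := hspec v
    cases hk : d v with
    | zero =>
      rw [hk] at h1
      exact absurd h1 hv
    | succ k =>
      rw [hk] at h1
      obtain ⟨w, hvw, hw⟩ := h1
      have h2 : d w ≤ k := hmin w hw
      have h3 : d v ≤ d w + 1 := hmin v (k := d w + 1) ⟨w, hvw, hspec w⟩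
      exact ⟨w, hvw, by omega⟩

variable {D : Digraph V} {S : Finset V} {d : V → ℕ}

lemma IsLevelFunction.exists_eq (h : IsLevelFunction D S d) (v : V) {j : ℕ} (hj : j ≤ d v) :
    ∃ u, d u = j := by
  obtain ⟨m, hm⟩ := Nat.exists_eq_add_of_le hj
  induction m generalizing v with
  | zero => exact ⟨v, by simpa using hm⟩
  | succ m ih =>
    have hv : v ∉ S := fun hv => by
      have := (h.eq_zero_iff v).2 hv
      omega
    obtain ⟨w, -, hw⟩ := h.exists_adj v hv
    exact ih w (by omega) (by omega)

variable [Fintype V]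

lemma IsLevelFunction.Icc_subset_image_levels (h : IsLevelFunction D S d) (v : V) :
    Finset.Icc 1 (d v) ⊆ (Finset.univ.filter fun u => 1 ≤ d u ∧ d u ≤ d v).image d := by
  classical
  intro j hj
  rw [Finset.mem_Icc] at hj
  obtain ⟨u, hu⟩ := h.exists_eq v hj.2
  exact Finset.mem_image.2 ⟨u, by simp [hu, hj], hu⟩

lemma IsLevelFunction.card_add_card_levels_le (h : IsLevelFunction D S d) (m : ℕ) :
    S.card + (Finset.univ.filter fun u => 1 ≤ d u ∧ d u ≤ m).card ≤ Fintype.card V := by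
  classical
  rw [← Finset.card_union_of_disjoint]
  · exact Finset.card_le_univ _
  · rw [Finset.disjoint_left]
    intro v hv hv'
    have := (h.eq_zero_iff v).2 hv
    simp [this] at hv'

lemma IsLevelFunction.card_add_le (h : IsLevelFunction D S d) (v : V) :
    S.card + d v ≤ Fintype.card V := by
  classical
  have h1 := (Finset.card_le_card (h.Icc_subset_image_levels v)).trans Finset.card_image_le
  have h2 := h.card_add_card_levels_le (d v)
  simp only [Nat.card_Icc] at h1
  omega

/-- Two vertices on a common level leave room for one level less. -/
lemma IsLevelFunction.card_add_lt (h : IsLevelFunction D S d) {u v : V} (huv : u ≠ v)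
    (he : d u = d v) (hv : d v ≠ 0) : S.card + d v < Fintype.card V := by
  classical
  have h1 := Finset.card_le_card (h.Icc_subset_image_levels v)
  have h2 := h.card_add_card_levels_le (d v)
  have h3 : ((Finset.univ.filter fun u => 1 ≤ d u ∧ d u ≤ d v).image d).card <
      (Finset.univ.filter fun u => 1 ≤ d u ∧ d u ≤ d v).card := by
    refine lt_of_le_of_ne Finset.card_image_le fun hc => huv ?_
    refine Finset.card_image_iff.1 hc ?_ ?_ he <;> simp <;> omega
  simp only [Nat.card_Icc] at h1
  omega

open Classical in
/-- The test vector `μ ^ (-d)` shows `q D ≥ 1 + μ` as soon as `Q x ≥ (1 + μ) x` holds on `S`.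
The strict inequality at the vertices of `S` survives a small increase of `μ`, so no equality
discussion for irreducible matrices is needed. -/
lemma IsLevelFunction.lt_q [Nonempty V] (h : IsLevelFunction D S d) {μ : ℝ} (hμ : 0 < μ)
    (hS : ∀ s ∈ S, 1 + μ < outDegree D s + ∑ w with D.Adj s w, μ⁻¹ ^ d w) : 1 + μ < q D := by
  have hev : ∀ᶠ t in nhdsWithin μ (Set.Ioi μ),
      ∀ s ∈ S, 1 + t < (outDegree D s : ℝ) + ∑ w with D.Adj s w, t⁻¹ ^ d w := by
    rw [Filter.eventually_all_finset]
    intro s hs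
    refine Filter.Eventually.filter_mono nhdsWithin_le_nhds ?_
    refine ContinuousAt.eventually_lt (by fun_prop) ?_ (hS s hs)
    refine continuousAt_const.add (tendsto_finsetSum _ fun w _ => ?_)
    exact (continuousAt_inv₀ hμ.ne').pow _
  obtain ⟨t, ht, hμt⟩ := (hev.and self_mem_nhdsWithin).exists
  have ht0 : 0 < t := hμ.trans hμt
  have hpos (v : V) : 0 < t⁻¹ ^ d v := by positivity
  have hle : 1 + t ≤ q D := by
    refine le_q_of_le_signlessAct D (x := fun v => t⁻¹ ^ d v) (by positivity) hpos fun v => ?_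
    by_cases hv : v ∈ S
    · have := (ht v hv).le
      simpa [signlessAct, (h.eq_zero_iff v).2 hv] using this
    · obtain ⟨w, hvw, hw⟩ := h.exists_adj v hv
      have hdeg : (1 : ℝ) ≤ outDegree D v := by
        exact_mod_cast Finset.card_pos.2 ⟨w, by simp [hvw]⟩
      have hsum : t⁻¹ ^ d w ≤ ∑ u with D.Adj v u, t⁻¹ ^ d u :=
        Finset.single_le_sum (f := fun u => t⁻¹ ^ d u) (fun u _ => (hpos u).le) (by simp [hvw])
      have hxw : t * t⁻¹ ^ d v = t⁻¹ ^ d w := by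
        rw [← hw, pow_succ]
        field_simp
      have := mul_le_mul_of_nonneg_right hdeg (hpos v).le
      simp only [signlessAct]
      linarith
  have : μ < t := hμt
  linarith

end Level

/-! ### The theta digraphs -/

section Branch

variable {V : Type*} [Fintype V]

/-- If `s` is the only vertex with two out-neighbours `w₁`, `w₂`, then the vector `μ ^ (-d)` is an
eigenvector for the eigenvalue `1 + μ`, where `μ` solves the equation at `s`. -/
lemma q_eq_of_unique_branch {D : Digraph V} {d : V → ℕ} {s w₁ w₂ : V} (hd : d s = 0)
    (hs : ∀ y, D.Adj s y ↔ y = w₁ ∨ y = w₂) (hw : w₁ ≠ w₂)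
    (hout : ∀ v ≠ s, ∃ w, (∀ y, D.Adj v y ↔ y = w) ∧ d w + 1 = d v) {μ : ℝ} (hμ : 0 < μ)
    (hroot : μ - 1 = μ⁻¹ ^ d w₁ + μ⁻¹ ^ d w₂) : q D = 1 + μ := by
  classical
  have : Nonempty V := ⟨s⟩
  refine q_eq_of_signlessAct_eq D (x := fun v => μ⁻¹ ^ d v) (by positivity)
    (fun v => by positivity) fun v => ?_
  by_cases hv : v = s
  · subst hv
    have hf : (Finset.univ.filter fun w => D.Adj v w) = {w₁, w₂} := by
      ext y
      simp [hs]
    have hdeg : outDegree D v = 2 := by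
      unfold outDegree
      convert Finset.card_pair hw
    simp only [signlessAct, hdeg, hd]
    have hsum : (∑ w with D.Adj v w, μ⁻¹ ^ d w) = μ⁻¹ ^ d w₁ + μ⁻¹ ^ d w₂ := by
      rw [hf, Finset.sum_pair hw]
    convert_to (2 : ℕ) * μ⁻¹ ^ 0 + (∑ w with D.Adj v w, μ⁻¹ ^ d w) = (1 + μ) * μ⁻¹ ^ 0
    rw [hsum, ← hroot]
    push_cast
    ring
  · obtain ⟨w, hvw, hdw⟩ := hout v hv
    have hf : (Finset.univ.filter fun y => D.Adj v y) = {w} := by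
      ext y
      simp [hvw]
    have hdeg : outDegree D v = 1 := by
      unfold outDegree
      convert Finset.card_singleton w
    have hsum : (∑ y with D.Adj v y, μ⁻¹ ^ d y) = μ⁻¹ ^ d w := by
      rw [hf, Finset.sum_singleton]
    simp only [signlessAct, hdeg]
    convert_to (1 : ℕ) * μ⁻¹ ^ d v + (∑ y with D.Adj v y, μ⁻¹ ^ d y) = (1 + μ) * μ⁻¹ ^ d v
    rw [hsum, ← hdw, pow_succ]
    push_cast
    field_simp

end Branch

/-- Labels `0, …, a + b + c + 1` of the vertices of `θ(a, b, c)`: the path from the hub `true` to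
the hub `false` gets `c + 1, …, 0`, and the inner vertices of the other two paths get
`b + c + 1, …, c + 2` and `a + b + c + 1, …, b + c + 2`, all in the direction of the arcs. -/
def thetaLabel (a b c : ℕ) : ThetaVertex a b c → ℕ
  | .inl false => 0
  | .inl true => c + 1
  | .inr (.inl i) => a + b + c + 1 - i
  | .inr (.inr (.inl i)) => b + c + 1 - i
  | .inr (.inr (.inr i)) => c - i

/-- The arcs of `θ(a, b, c)` in terms of labels. -/
def ThetaArc (a b c k l : ℕ) : Prop :=
  (k = 0 ∧ (l = b + c + 1 ∨ l = if a = 0 then c + 1 else a + b + c + 1)) ∨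
    (k ≠ 0 ∧ l = if k = b + c + 2 then c + 1 else k - 1)

lemma thetaLabel_injective (a b c : ℕ) : Function.Injective (thetaLabel a b c) := by
  rintro ((_ | _) | i | i | i) ((_ | _) | j | j | j) h <;> simp only [thetaLabel] at h <;>
    first
    | rfl
    | (exfalso; omega)
    | (have hij : i = j := Fin.ext (by omega)
       rw [hij])

lemma thetaLabel_lt (a b c : ℕ) (x : ThetaVertex a b c) : thetaLabel a b c x < a + b + c + 2 := by
  rcases x with (_ | _) | i | i | i <;> simp only [thetaLabel] <;> omega

lemma card_thetaVertex (a b c : ℕ) : Fintype.card (ThetaVertex a b c) = a + b + c + 2 := by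
  simp [ThetaVertex]
  omega

lemma exists_thetaLabel_eq {a b c k : ℕ} (hk : k < a + b + c + 2) :
    ∃ x, thetaLabel a b c x = k := by
  have hbij : Function.Bijective
      fun x => (⟨thetaLabel a b c x, thetaLabel_lt a b c x⟩ : Fin (a + b + c + 2)) :=
    (Fintype.bijective_iff_injective_and_card _).2
      ⟨fun x y h => thetaLabel_injective a b c (Fin.mk.inj_iff.1 h), by
        rw [card_thetaVertex, Fintype.card_fin]⟩
  obtain ⟨x, hx⟩ := hbij.2 ⟨k, hk⟩
  exact ⟨x, Fin.mk.inj_iff.1 hx⟩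

lemma pathArc_iff_of_label {V : Type*} {m : ℕ} {s t : V} {f : Fin m → V} {L : V → ℕ}
    (hL : Function.Injective L) {g : ℕ → ℕ} (hg : ∀ i ≤ m + 1, L (pathVertex s f t i) = g i)
    (x y : V) : PathArc s f t x y ↔ ∃ i ≤ m, L x = g i ∧ L y = g (i + 1) := by
  refine exists_congr fun i => and_congr_right fun hi => ?_
  rw [← hg i (by omega), ← hg (i + 1) (by omega), hL.eq_iff, hL.eq_iff]

lemma theta_adj_iff (a b c : ℕ) (x y : ThetaVertex a b c) :
    (theta a b c).Adj x y ↔ ThetaArc a b c (thetaLabel a b c x) (thetaLabel a b c y) := by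
  have hL := thetaLabel_injective a b c
  have ha := pathArc_iff_of_label hL (s := Sum.inl false) (t := Sum.inl true)
    (f := fun i : Fin a => Sum.inr (Sum.inl i))
    (g := fun i => if i = 0 then 0 else if i ≤ a then a + b + c + 2 - i else c + 1)
    (by
      intro i hi
      unfold pathVertex
      split_ifs <;> simp only [thetaLabel] <;> omega) x y
  have hb := pathArc_iff_of_label hL (s := Sum.inl false) (t := Sum.inl true)
    (f := fun i : Fin b => Sum.inr (Sum.inr (Sum.inl i)))
    (g := fun i => if i = 0 then 0 else b + c + 2 - i)
    (by
      intro i hi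
      unfold pathVertex
      split_ifs <;> simp only [thetaLabel] <;> omega) x y
  have hc := pathArc_iff_of_label hL (s := Sum.inl true) (t := Sum.inl false)
    (f := fun i : Fin c => Sum.inr (Sum.inr (Sum.inr i))) (g := fun i => c + 1 - i)
    (by
      intro i hi
      unfold pathVertex
      split_ifs <;> simp only [thetaLabel] <;> omega) x y
  have hx := thetaLabel_lt a b c x
  simp only [theta, ha, hb, hc]
  clear ha hb hc
  generalize thetaLabel a b c x = k at *
  generalize thetaLabel a b c y = l at *
  unfold ThetaArc
  constructor
  · rintro (⟨i, hi, h1, h2⟩ | ⟨i, hi, h1, h2⟩ | ⟨i, hi, h1, h2⟩) <;> split_ifs at * <;> omega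
  · rintro (⟨rfl, h | h⟩ | ⟨h0, h⟩)
    · exact Or.inr (Or.inl ⟨0, by omega, by simp, by simp; omega⟩)
    · refine Or.inl ⟨0, by omega, by simp, ?_⟩
      split_ifs at * <;> omega
    · by_cases h1 : k ≤ c + 1
      · refine Or.inr (Or.inr ⟨c + 1 - k, by omega, by omega, ?_⟩)
        split_ifs at * <;> omega
      · by_cases h2 : k ≤ b + c + 1
        · refine Or.inr (Or.inl ⟨b + c + 2 - k, by omega, ?_, ?_⟩) <;> split_ifs at * <;> omega
        · refine Or.inl ⟨a + b + c + 2 - k, by omega, ?_, ?_⟩ <;>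
            split_ifs at * <;> omega

lemma isSimple_theta {a b c : ℕ} : IsSimple (theta a b c) := by
  intro v hv
  rw [theta_adj_iff] at hv
  unfold ThetaArc at hv
  have := thetaLabel_lt a b c v
  split_ifs at hv <;> omega

section Path

variable {V : Type*} {m : ℕ} {s t : V} {f : Fin m → V} {r : V → V → Prop}

lemma reflTransGen_pathVertex (h : ∀ x y, PathArc s f t x y → r x y) {i j : ℕ} (hij : i ≤ j)
    (hj : j ≤ m + 1) : Relation.ReflTransGen r (pathVertex s f t i) (pathVertex s f t j) := by
  induction j, hij using Nat.le_induction with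
  | base => exact .refl
  | succ j hij ih => exact (ih (by omega)).tail (h _ _ ⟨j, by omega, rfl, rfl⟩)

lemma reflTransGen_of_pathArc (h : ∀ x y, PathArc s f t x y → r x y) :
    Relation.ReflTransGen r s t := by
  simpa [pathVertex] using reflTransGen_pathVertex h (Nat.zero_le (m + 1)) le_rfl

lemma reflTransGen_inner (h : ∀ x y, PathArc s f t x y → r x y) (i : Fin m) :
    Relation.ReflTransGen r s (f i) ∧ Relation.ReflTransGen r (f i) t := by
  have h1 := reflTransGen_pathVertex h (Nat.zero_le (i + 1)) (by omega)
  have h2 := reflTransGen_pathVertex h (show i.val + 1 ≤ m + 1 by omega) le_rfl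
  exact ⟨by simpa [pathVertex] using h1, by simpa [pathVertex] using h2⟩

end Path

lemma isStronglyConnected_theta (a b c : ℕ) : IsStronglyConnected (theta a b c) := by
  have hst := reflTransGen_of_pathArc (r := (theta a b c).Adj) fun x y h => Or.inl h
  have hts := reflTransGen_of_pathArc (r := (theta a b c).Adj) fun x y h => Or.inr (Or.inr h)
  have key (v : ThetaVertex a b c) : Relation.ReflTransGen (theta a b c).Adj (.inl false) v ∧
      Relation.ReflTransGen (theta a b c).Adj v (.inl false) := by
    rcases v with (_ | _) | i | i | i
    · exact ⟨.refl, .refl⟩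
    · exact ⟨hst, hts⟩
    · have := reflTransGen_inner (r := (theta a b c).Adj) (fun x y h => Or.inl h) i
      exact ⟨this.1, this.2.trans hts⟩
    · have := reflTransGen_inner (r := (theta a b c).Adj) (fun x y h => Or.inr (Or.inl h)) i
      exact ⟨this.1, this.2.trans hts⟩
    · have := reflTransGen_inner (r := (theta a b c).Adj) (fun x y h => Or.inr (Or.inr h)) i
      exact ⟨hst.trans this.1, this.2⟩
  exact fun u v => (key u).2.trans (key v).1

lemma q_theta {a b c : ℕ} (hab : a ≠ 0 ∨ b ≠ 0) {μ : ℝ} (hμ : 0 < μ)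
    (hroot : μ - 1 = μ⁻¹ ^ (b + c + 1) + μ⁻¹ ^ (a + c + 1)) : q (theta a b c) = 1 + μ := by
  obtain ⟨w₁, h₁⟩ := exists_thetaLabel_eq (a := a) (b := b) (c := c) (k := b + c + 1) (by omega)
  obtain ⟨w₂, h₂⟩ := exists_thetaLabel_eq (a := a) (b := b) (c := c)
    (k := if a = 0 then c + 1 else a + b + c + 1) (by split_ifs <;> omega)
  have hL {x y} : thetaLabel a b c x = thetaLabel a b c y ↔ x = y :=
    (thetaLabel_injective a b c).eq_iff
  -- the distance to the hub `false`
  let d : ThetaVertex a b c → ℕ := fun v =>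
    if thetaLabel a b c v ≤ b + c + 1 then thetaLabel a b c v else thetaLabel a b c v - b
  have h0 : thetaLabel a b c (.inl false) = 0 := rfl
  refine q_eq_of_unique_branch (d := d) (s := .inl false) (w₁ := w₁) (w₂ := w₂) ?_ ?_ ?_ ?_ hμ ?_
  · simp [d, h0]
  · intro y
    rw [theta_adj_iff, ← hL, ← hL, h₁, h₂, h0]
    simp [ThetaArc]
  · rw [Ne, ← hL, h₁, h₂]
    split_ifs <;> omega
  · intro v hv
    rw [Ne, ← hL, h0] at hv
    have hlt := thetaLabel_lt a b c v
    obtain ⟨w, hw⟩ := exists_thetaLabel_eq (a := a) (b := b) (c := c)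
      (k := if thetaLabel a b c v = b + c + 2 then c + 1 else thetaLabel a b c v - 1)
      (by split_ifs <;> omega)
    refine ⟨w, fun y => ?_, ?_⟩
    · rw [theta_adj_iff, ← hL, hw]
      simp [ThetaArc, hv]
    · simp only [d, hw]
      split_ifs <;> omega
  · have e₁ : d w₁ = b + c + 1 := by simp [d, h₁]
    have e₂ : d w₂ = a + c + 1 := by
      simp only [d, h₂]
      split_ifs <;> omega
    rw [e₁, e₂, hroot]

/-! ### Directed cycles -/

lemma exists_adj_to {V : Type*} [Nontrivial V] {D : Digraph V}
    (hD : IsStronglyConnected D) (v : V) :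
    ∃ u, D.Adj u v := by
  obtain ⟨u, hu⟩ := exists_ne v
  rcases (hD u v).cases_tail with h | ⟨w, -, hw⟩
  · exact absurd h.symm hu
  · exact ⟨w, hw⟩

section OutDegree

variable {V : Type*} [Fintype V] {D : Digraph V}

lemma exists_adj_iff_of_outDegree_eq_one {v : V} (h : outDegree D v = 1) :
    ∃ w, ∀ y, D.Adj v y ↔ y = w := by
  classical
  unfold outDegree at h
  obtain ⟨w, hw⟩ := Finset.card_eq_one.1 h
  refine ⟨w, fun y => ?_⟩
  have := Finset.ext_iff.1 hw y
  simpa using this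

lemma exists_adj_iff_of_outDegree_eq_two {v : V} (h : outDegree D v = 2) :
    ∃ w₁ w₂, w₁ ≠ w₂ ∧ ∀ y, D.Adj v y ↔ y = w₁ ∨ y = w₂ := by
  classical
  unfold outDegree at h
  obtain ⟨w₁, w₂, hne, hw⟩ := Finset.card_eq_two.1 h
  refine ⟨w₁, w₂, hne, fun y => ?_⟩
  have := Finset.ext_iff.1 hw y
  simpa using this

lemma exists_adj_ne_of_two_le_outDegree {v : V} (h : 2 ≤ outDegree D v) :
    ∃ w₁ w₂, w₁ ≠ w₂ ∧ D.Adj v w₁ ∧ D.Adj v w₂ := by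
  classical
  unfold outDegree at h
  obtain ⟨w₁, h₁, w₂, h₂, hne⟩ := Finset.one_lt_card.1 h
  exact ⟨w₁, w₂, hne, by simpa using h₁, by simpa using h₂⟩

lemma outDegree_pos [Nontrivial V] (hD : IsStronglyConnected D) (v : V) : 0 < outDegree D v := by
  classical
  obtain ⟨u, hu⟩ := exists_ne v
  rcases (hD v u).cases_head with h | ⟨w, hw, -⟩
  · exact absurd h.symm hu
  · exact Finset.card_pos.2 ⟨w, by simp [hw]⟩

lemma q_eq_two_of_outDegree_eq_one [Nonempty V] (h : ∀ v, outDegree D v = 1) : q D = 2 := by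
  classical
  refine q_eq_of_signlessAct_eq D (x := fun _ => 1) (by norm_num) (fun _ => one_pos) fun v => ?_
  have hv := h v
  have hc : (Finset.univ.filter fun w => D.Adj v w).card = 1 := by
    rw [← hv]
    unfold outDegree
    congr
  simp only [signlessAct, hv, Finset.sum_const, nsmul_eq_mul]
  convert_to ((1 : ℕ) : ℝ) * 1 + ((Finset.univ.filter fun w => D.Adj v w).card : ℝ) * 1 = 2 * 1
  rw [hc]
  norm_num

end OutDegree

lemma directedCycle_adj_iff {n : ℕ} (i j : Fin n) : (directedCycle n).Adj i j ↔
    (n - 1 - j.val) + 1 = n - 1 - i.val ∨ (n - 1 - i.val = 0 ∧ n - 1 - j.val + 1 = n) := by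
  have hi := i.isLt
  have hj := j.isLt
  simp only [directedCycle]
  by_cases h : i.val + 1 < n
  · rw [Nat.mod_eq_of_lt h]
    omega
  · have : i.val + 1 = n := by omega
    rw [this, Nat.mod_self]
    omega

lemma isSimple_directedCycle {n : ℕ} (hn : 2 ≤ n) : IsSimple (directedCycle n) := by
  intro i hi
  rw [directedCycle_adj_iff] at hi
  omega

lemma isStronglyConnected_directedCycle (n : ℕ) : IsStronglyConnected (directedCycle n) := by
  have up (i : Fin n) (j : ℕ) (hij : i.val ≤ j) (hj : j < n) :
      Relation.ReflTransGen (directedCycle n).Adj i ⟨j, hj⟩ := by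
    induction j, hij using Nat.le_induction with
    | base => exact .refl
    | succ j hij ih =>
      exact (ih (by omega)).tail (Nat.mod_eq_of_lt hj)
  intro i j
  have hn : 0 < n := i.pos
  have h1 := up i (n - 1) (by omega) (by omega)
  have h2 : (directedCycle n).Adj ⟨n - 1, by omega⟩ ⟨0, hn⟩ := by
    simp [directedCycle, Nat.sub_add_cancel hn]
  exact (h1.tail h2).trans (up ⟨0, hn⟩ j (Nat.zero_le _) j.isLt)

lemma outDegree_directedCycle {n : ℕ} (i : Fin n) : outDegree (directedCycle n) i = 1 := by
  classical
  unfold outDegree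
  rw [Finset.card_eq_one]
  refine ⟨⟨(i.val + 1) % n, Nat.mod_lt _ i.pos⟩, ?_⟩
  ext j
  simp [directedCycle, Fin.ext_iff, eq_comm]

/-- A strongly connected digraph with all outdegrees `1` is a directed cycle: the out-neighbour map
is a permutation, hence the distance to a fixed vertex is injective. -/
lemma isIso_directedCycle {V : Type*} [Fintype V] [Nontrivial V] {D : Digraph V} {n : ℕ}
    (hn : Fintype.card V = n) (hD : IsStronglyConnected D) (h1 : ∀ v, outDegree D v = 1) :
    IsIso D (directedCycle n) := by
  classical
  choose f hf using fun v => exists_adj_iff_of_outDegree_eq_one (h1 v)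
  have fsurj : Function.Surjective f := fun v => by
    obtain ⟨u, hu⟩ := exists_adj_to hD v
    exact ⟨u, ((hf u v).1 hu).symm⟩
  have finj : Function.Injective f := Finite.injective_iff_surjective.2 fsurj
  obtain ⟨s⟩ : Nonempty V := inferInstance
  obtain ⟨d, hd⟩ := exists_isLevelFunction hD (Finset.singleton_nonempty s)
  have hd0 (v : V) : d v = 0 ↔ v = s := by simpa using hd.eq_zero_iff v
  have hdf {v : V} (hv : v ≠ s) : d (f v) + 1 = d v := by
    obtain ⟨w, hvw, hw⟩ := hd.exists_adj v (by simpa using hv)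
    rwa [← (hf v w).1 hvw]
  have dinj : Function.Injective d := by
    intro u v huv
    induction hk : d u generalizing u v with
    | zero => rw [(hd0 u).1 hk, (hd0 v).1 (by omega)]
    | succ k ih =>
      have hu := hdf (v := u) (by rw [Ne, ← hd0]; omega)
      have hv := hdf (v := v) (by rw [Ne, ← hd0]; omega)
      exact finj (ih (by omega) (by omega))
  have dlt (v : V) : d v < n := by
    have := hd.card_add_le v
    rw [Finset.card_singleton] at this
    omega
  have htop : d (f s) + 1 = n := by
    have hbij : Function.Bijective fun v => (⟨d v, dlt v⟩ : Fin n) :=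
      (Fintype.bijective_iff_injective_and_card _).2
        ⟨fun a b h => dinj (Fin.mk.inj_iff.1 h), by simp [hn]⟩
    have hn0 := dlt s
    obtain ⟨v, hv⟩ := hbij.2 ⟨n - 1, by omega⟩
    have hv' : d v = n - 1 := Fin.mk.inj_iff.1 hv
    obtain ⟨u, rfl⟩ := fsurj v
    by_cases hu : u = s
    · subst hu
      omega
    · have := hdf hu
      have := dlt u
      omega
  refine isIso_of_labels (n := n) (R := fun k l => l + 1 = k ∨ (k = 0 ∧ l + 1 = n)) (L := d)
    (M := fun i : Fin n => n - 1 - i.val) hn (by simp) dinj ?_ dlt ?_ ?_ directedCycle_adj_iff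
  · intro i j hij
    have := i.isLt
    have := j.isLt
    simp only at hij
    exact Fin.ext (by omega)
  · intro i
    have := i.isLt
    omega
  · intro x y
    rw [hf, ← dinj.eq_iff]
    by_cases hx : x = s
    · subst hx
      have := (hd0 x).2 rfl
      omega
    · have := hdf hx
      have := (hd0 x).not.2 hx
      omega

/-! ### Digraphs with a single branching vertex -/

section Branch

variable {V : Type*} [Fintype V] {D : Digraph V} {d : V → ℕ} {s w₁ w₂ : V}

/-- If one of the two out-neighbours of the only branching vertex is at the largest conceivable
distance, then the distances label the vertices. -/
lemma isIso_theta_zero {b c : ℕ} (hV : Fintype.card V = b + c + 2)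
    (hd : IsLevelFunction D {s} d) (hs : ∀ y, D.Adj s y ↔ y = w₁ ∨ y = w₂)
    (hout : ∀ v ≠ s, ∃ w, ∀ y, D.Adj v y ↔ y = w)
    (h₁ : d w₁ = b + c + 1) (h₂ : d w₂ = c + 1) : IsIso D (theta 0 b c) := by
  classical
  have hd0 (v : V) : d v = 0 ↔ v = s := by simpa using hd.eq_zero_iff v
  have dlt (v : V) : d v < 0 + b + c + 2 := by
    have := hd.card_add_le v
    rw [Finset.card_singleton] at this
    omega
  have hbij : Function.Bijective fun v => (⟨d v, dlt v⟩ : Fin (0 + b + c + 2)) := by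
    refine (Fintype.bijective_iff_surjective_and_card _).2 ⟨fun j => ?_, by simp [hV]⟩
    obtain ⟨u, hu⟩ := hd.exists_eq w₁ (j := j) (by omega)
    exact ⟨u, Fin.ext hu⟩
  have dinj : Function.Injective d := fun u v huv => hbij.1 (Fin.ext huv)
  refine isIso_of_labels (n := 0 + b + c + 2) (R := ThetaArc 0 b c) (L := d) (by omega)
    (card_thetaVertex 0 b c) dinj (thetaLabel_injective 0 b c) dlt (thetaLabel_lt 0 b c) ?_
    (theta_adj_iff 0 b c)
  intro x y
  by_cases hx : x = s
  · subst hx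
    rw [hs, ← dinj.eq_iff, ← dinj.eq_iff, h₁, h₂, (hd0 x).2 rfl]
    simp [ThetaArc]
  · obtain ⟨w, hw⟩ := hout x hx
    obtain ⟨w', hxw, hdw⟩ := hd.exists_adj x (by simpa using hx)
    obtain rfl := (hw w').1 hxw
    have hx0 := (hd0 x).not.2 hx
    have hlt := dlt x
    have hne : d x ≠ b + c + 2 := by omega
    rw [hw, ← dinj.eq_iff]
    simp only [ThetaArc, hx0, hne, false_and, false_or, if_false, not_false_eq_true, true_and,
      ne_eq]
    omega

/-- If both out-neighbours of the only branching vertex are at the second largest conceivable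
distance, then the distances label all vertices except for one of these two. -/
lemma isIso_theta_one_one {c : ℕ} (hV : Fintype.card V = c + 4)
    (hd : IsLevelFunction D {s} d) (hs : ∀ y, D.Adj s y ↔ y = w₁ ∨ y = w₂) (hne : w₁ ≠ w₂)
    (hout : ∀ v ≠ s, ∃ w, ∀ y, D.Adj v y ↔ y = w)
    (h₁ : d w₁ = c + 2) (h₂ : d w₂ = c + 2) : IsIso D (theta 1 1 c) := by
  classical
  have hd0 (v : V) : d v = 0 ↔ v = s := by simpa using hd.eq_zero_iff v
  have dlt (v : V) : d v < c + 4 := by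
    have := hd.card_add_le v
    rw [Finset.card_singleton] at this
    omega
  let L : V → ℕ := fun v => if v = w₁ then c + 3 else d v
  have hL₁ : L w₁ = c + 3 := if_pos rfl
  have hL {v : V} (hv : v ≠ w₁) : L v = d v := if_neg hv
  have Llt (v : V) : L v < 1 + 1 + c + 2 := by
    have := dlt v
    simp only [L]
    split_ifs <;> omega
  have hbij : Function.Bijective fun v => (⟨L v, Llt v⟩ : Fin (1 + 1 + c + 2)) := by
    refine (Fintype.bijective_iff_surjective_and_card _).2
      ⟨fun j => ?_, by simp [hV]; omega⟩
    have hj := j.isLt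
    by_cases h3 : j.val = c + 3
    · exact ⟨w₁, Fin.ext (hL₁.trans h3.symm)⟩
    by_cases h4 : j.val = c + 2
    · exact ⟨w₂, Fin.ext ((hL hne.symm).trans (h₂.trans h4.symm))⟩
    obtain ⟨u, hu⟩ := hd.exists_eq w₁ (j := j) (by omega)
    have hu1 : u ≠ w₁ := by
      rintro rfl
      omega
    exact ⟨u, Fin.ext ((hL hu1).trans hu)⟩
  have Linj : Function.Injective L := fun u v huv => hbij.1 (Fin.ext huv)
  refine isIso_of_labels (n := 1 + 1 + c + 2) (R := ThetaArc 1 1 c) (L := L) (by omega)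
    (card_thetaVertex 1 1 c) Linj (thetaLabel_injective 1 1 c) Llt (thetaLabel_lt 1 1 c) ?_
    (theta_adj_iff 1 1 c)
  intro x y
  by_cases hx : x = s
  · subst hx
    have hx0 := (hd0 x).2 rfl
    have hx1 : x ≠ w₁ := by
      rintro rfl
      omega
    rw [hs, ← Linj.eq_iff, ← Linj.eq_iff, hL₁, hL hne.symm, h₂, hL hx1, hx0]
    simp only [ThetaArc]
    simp
    omega
  · obtain ⟨w, hw⟩ := hout x hx
    obtain ⟨w', hxw, hdw⟩ := hd.exists_adj x (by simpa using hx)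
    obtain rfl := (hw w').1 hxw
    have hx0 := (hd0 x).not.2 hx
    rw [hw, ← Linj.eq_iff]
    by_cases hx1 : x = w₁
    · subst hx1
      have hw1 : w' ≠ x := by
        rintro rfl
        omega
      have hw' : d w' = c + 1 := by omega
      rw [hL₁, hL hw1, hw', ThetaArc, if_neg one_ne_zero, if_pos (by omega)]
      omega
    · have hx3 : d x ≠ c + 3 := fun h => hx1 (Linj (by rw [hL hx1, hL₁, h]))
      have hlt := dlt x
      have hw1 : w' ≠ w₁ := by
        rintro rfl
        omega
      rw [hL hx1, hL hw1]
      unfold ThetaArc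
      split_ifs <;> omega

end Branch

/-! ### The equations for the spectral radii -/

lemma exists_root (k l : ℕ) : ∃ μ : ℝ, 1 < μ ∧ μ - 1 = μ⁻¹ ^ k + μ⁻¹ ^ l := by
  have hcont : ContinuousOn (fun t : ℝ => t - 1 - (t⁻¹ ^ k + t⁻¹ ^ l)) (Set.Icc 1 3) := by
    have hinv : ContinuousOn (fun t : ℝ => t⁻¹) (Set.Icc 1 3) :=
      continuousOn_inv₀.mono fun t ht => by
        have := ht.1
        simp only [Set.mem_compl_iff, Set.mem_singleton_iff]
        linarith
    exact (continuousOn_id.sub continuousOn_const).sub ((hinv.pow k).add (hinv.pow l))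
  have h3 (m : ℕ) : (3 : ℝ)⁻¹ ^ m ≤ 1 := pow_le_one₀ (by norm_num) (by norm_num)
  have hmem : (0 : ℝ) ∈ Set.Icc ((1 : ℝ) - 1 - (1⁻¹ ^ k + 1⁻¹ ^ l))
      ((3 : ℝ) - 1 - (3⁻¹ ^ k + 3⁻¹ ^ l)) :=
    ⟨by norm_num, by linarith [h3 k, h3 l]⟩
  obtain ⟨μ, ⟨h1, -⟩, h0⟩ := intermediate_value_Icc (by norm_num : (1 : ℝ) ≤ 3) hcont hmem
  have h0' : μ - 1 - (μ⁻¹ ^ k + μ⁻¹ ^ l) = 0 := h0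
  refine ⟨μ, lt_of_le_of_ne h1 ?_, by linarith⟩
  rintro rfl
  norm_num at h0'

/-- The root is larger if the right hand side is, because the right hand side decreases. -/
lemma root_lt_root {μ ν : ℝ} {k l k' l' : ℕ} (hν : 1 < ν)
    (hμr : μ - 1 = μ⁻¹ ^ k + μ⁻¹ ^ l) (hνr : ν - 1 = ν⁻¹ ^ k' + ν⁻¹ ^ l')
    (h : μ⁻¹ ^ k + μ⁻¹ ^ l < μ⁻¹ ^ k' + μ⁻¹ ^ l') : μ < ν := by
  by_contra! hle
  have hν0 : 0 < ν := by linarith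
  have hμ0 : 0 < μ := by linarith
  have hinv : μ⁻¹ ≤ ν⁻¹ := inv_anti₀ hν0 hle
  have h0 : 0 ≤ μ⁻¹ := by positivity
  have h1 := pow_le_pow_left₀ h0 hinv k'
  have h2 := pow_le_pow_left₀ h0 hinv l'
  linarith

section Powers

variable {t : ℝ} {c : ℕ}

lemma pow_add_pow_lt_two_mul (h0 : 0 < t) (h1 : t < 1) :
    t ^ (c + 3) + t ^ (c + 2) < t ^ (c + 2) + t ^ (c + 2) := by
  have := pow_lt_pow_right_of_lt_one₀ h0 h1 (show c + 2 < c + 3 by omega)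
  linarith

/-- This is `2 μ < 1 + μ ^ 2`, divided by `μ ^ (c + 3)`, for `t = μ⁻¹`. -/
lemma two_mul_lt_pow_add_pow (h0 : 0 < t) (h1 : t < 1) :
    t ^ (c + 2) + t ^ (c + 2) < t ^ (c + 3) + t ^ (c + 1) := by
  have h : 0 < t ^ (c + 1) * (1 - t) ^ 2 := by
    have : 0 < 1 - t := by linarith
    positivity
  have e : t ^ (c + 1) * (1 - t) ^ 2 = t ^ (c + 3) + t ^ (c + 1) - (t ^ (c + 2) + t ^ (c + 2)) := by
    ring
  linarith

lemma pow_add_pow_lt_of_le (h0 : 0 < t) (h1 : t < 1) {k l : ℕ} (hk : k ≤ c + 2)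
    (hl : l ≤ c + 1) : t ^ (c + 3) + t ^ (c + 1) < t ^ k + t ^ l := by
  have h2 := pow_lt_pow_right_of_lt_one₀ h0 h1 (show k < c + 3 by omega)
  have h3 := pow_le_pow_of_le_one h0.le h1.le hl
  linarith

lemma pow_add_pow_lt_of_le' (h0 : 0 < t) (h1 : t < 1) {k l : ℕ} (hk : k ≤ c + 3)
    (hl : l ≤ c) : t ^ (c + 3) + t ^ (c + 1) < t ^ k + t ^ l := by
  have h2 := pow_lt_pow_right_of_lt_one₀ h0 h1 (show l < c + 1 by omega)
  have h3 := pow_le_pow_of_le_one h0.le h1.le hk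
  linarith

end Powers

lemma root_lt_two {c : ℕ} {μ : ℝ} (hμ : μ - 1 = μ⁻¹ ^ (c + 3) + μ⁻¹ ^ (c + 1)) : μ < 2 := by
  by_contra! hle
  have h0 : (0 : ℝ) ≤ μ⁻¹ := by positivity
  have hinv : μ⁻¹ ≤ 1 / 2 := by
    rw [← one_div]
    exact one_div_le_one_div_of_le (by norm_num) hle
  have h1 : μ⁻¹ ^ (c + 3) ≤ μ⁻¹ ^ 3 := pow_le_pow_of_le_one h0 (by linarith) (by omega)
  have h2 : μ⁻¹ ^ (c + 1) ≤ μ⁻¹ ^ 1 := pow_le_pow_of_le_one h0 (by linarith) (by omega)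
  have h3 : μ⁻¹ ^ 3 ≤ 1 / 8 := (pow_le_pow_left₀ h0 hinv 3).trans (by norm_num)
  rw [pow_one] at h2
  linarith

/-! ### The classification -/

section Classification

variable {V : Type*} [Fintype V] {D : Digraph V}

open Classical in
lemma lt_outDegree_add_sum {d : V → ℕ} {s w₁ w₂ : V} {μ : ℝ} (hμ : 0 < μ)
    (hdeg : 2 ≤ outDegree D s) (hne : w₁ ≠ w₂) (h₁ : D.Adj s w₁) (h₂ : D.Adj s w₂)
    (h : μ - 1 < μ⁻¹ ^ d w₁ + μ⁻¹ ^ d w₂) :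
    1 + μ < outDegree D s + ∑ w with D.Adj s w, μ⁻¹ ^ d w := by
  have hsum : μ⁻¹ ^ d w₁ + μ⁻¹ ^ d w₂ ≤ ∑ w with D.Adj s w, μ⁻¹ ^ d w := by
    rw [← Finset.sum_pair (f := fun w => μ⁻¹ ^ d w) hne]
    refine Finset.sum_le_sum_of_subset_of_nonneg ?_ fun w _ _ => by positivity
    intro w hw
    rcases Finset.mem_insert.1 hw with rfl | hw
    · simp [h₁]
    · rw [Finset.mem_singleton] at hw
      simp [hw, h₂]
  have hdeg' : (2 : ℝ) ≤ outDegree D s := by exact_mod_cast hdeg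
  linarith

/-- A strongly connected digraph on `c + 4` vertices is a directed cycle, one of the three theta
digraphs, or its spectral radius is larger than that of `θ(0, 2, c)`, which is `1 + μ`. -/
theorem isIso_or_lt_q {c : ℕ} (hV : Fintype.card V = c + 4) (hD : IsStronglyConnected D) {μ : ℝ}
    (hμ1 : 1 < μ) (hμ : μ - 1 = μ⁻¹ ^ (c + 3) + μ⁻¹ ^ (c + 1)) :
    IsIso D (directedCycle (c + 4)) ∨ IsIso D (theta 0 1 (c + 1)) ∨ IsIso D (theta 1 1 c) ∨
      IsIso D (theta 0 2 c) ∨ 1 + μ < q D := by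
  classical
  have : Nontrivial V := Fintype.one_lt_card_iff_nontrivial.1 (by omega)
  have hμ0 : 0 < μ := by linarith
  have ht0 : 0 < μ⁻¹ := by positivity
  have ht1 : μ⁻¹ < 1 := inv_lt_one_of_one_lt₀ hμ1
  let S : Finset V := Finset.univ.filter fun v => 2 ≤ outDegree D v
  have hS {v : V} : v ∈ S ↔ 2 ≤ outDegree D v := by simp [S]
  have hdeg1 {v : V} (hv : v ∉ S) : outDegree D v = 1 := by
    have := outDegree_pos hD v
    have := hS.not.1 hv
    omega
  rcases S.eq_empty_or_nonempty with hS0 | hSne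
  · exact Or.inl (isIso_directedCycle hV hD fun v => hdeg1 (by simp [hS0]))
  obtain ⟨d, hd⟩ := exists_isLevelFunction hD hSne
  -- it suffices to have large enough powers at each vertex of `S`
  have fin (h : ∀ s ∈ S, ∃ w₁ w₂, w₁ ≠ w₂ ∧ D.Adj s w₁ ∧ D.Adj s w₂ ∧
      μ⁻¹ ^ (c + 3) + μ⁻¹ ^ (c + 1) < μ⁻¹ ^ d w₁ + μ⁻¹ ^ d w₂) : 1 + μ < q D := by
    refine hd.lt_q hμ0 fun s hs => ?_
    obtain ⟨w₁, w₂, hne, h₁, h₂, hlt⟩ := h s hs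
    exact lt_outDegree_add_sum hμ0 (hS.1 hs) hne h₁ h₂ (by linarith)
  by_cases hS2 : 2 ≤ S.card
  · -- with two branching vertices the distances are at most `c + 2`, which is attained only once
    refine Or.inr (Or.inr (Or.inr (Or.inr (fin fun s hs => ?_))))
    obtain ⟨w₁, w₂, hne, h₁, h₂⟩ := exists_adj_ne_of_two_le_outDegree (hS.1 hs)
    have b₁ := hd.card_add_le w₁
    have b₂ := hd.card_add_le w₂
    by_cases hc : d w₂ ≤ c + 1
    · exact ⟨w₁, w₂, hne, h₁, h₂, pow_add_pow_lt_of_le ht0 ht1 (by omega) hc⟩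
    · refine ⟨w₂, w₁, hne.symm, h₂, h₁, pow_add_pow_lt_of_le ht0 ht1 (by omega) ?_⟩
      by_contra hc'
      have := hd.card_add_lt hne (by omega) (by omega)
      omega
  obtain ⟨s, hs⟩ : ∃ s, S = {s} := by
    have := hSne.card_pos
    exact Finset.card_eq_one.1 (by omega)
  have hsS : s ∈ S := by simp [hs]
  have hmem {v : V} : v ∈ S ↔ v = s := by simp [hs]
  have hout (v : V) (hv : v ≠ s) : ∃ w, ∀ y, D.Adj v y ↔ y = w :=
    exists_adj_iff_of_outDegree_eq_one (hdeg1 (hmem.not.2 hv))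
  by_cases hs3 : 3 ≤ outDegree D s
  · refine Or.inr (Or.inr (Or.inr (Or.inr (hd.lt_q hμ0 fun v hv => ?_))))
    obtain rfl := hmem.1 hv
    have h3 : (3 : ℝ) ≤ outDegree D v := by exact_mod_cast hs3
    have hsum : 0 ≤ ∑ w with D.Adj v w, μ⁻¹ ^ d w := Finset.sum_nonneg fun w _ => by positivity
    have := root_lt_two hμ
    linarith
  obtain ⟨w₁, w₂, hne, hadj, hle⟩ : ∃ w₁ w₂, w₁ ≠ w₂ ∧ (∀ y, D.Adj s y ↔ y = w₁ ∨ y = w₂) ∧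
      d w₂ ≤ d w₁ := by
    have := hS.1 hsS
    obtain ⟨w₁, w₂, hne, hadj⟩ := exists_adj_iff_of_outDegree_eq_two (D := D) (v := s) (by omega)
    rcases le_total (d w₂) (d w₁) with h | h
    · exact ⟨w₁, w₂, hne, hadj, h⟩
    · exact ⟨w₂, w₁, hne.symm, fun y => (hadj y).trans or_comm, h⟩
  have fin' (h : μ⁻¹ ^ (c + 3) + μ⁻¹ ^ (c + 1) < μ⁻¹ ^ d w₁ + μ⁻¹ ^ d w₂) : 1 + μ < q D := by
    refine fin fun v hv => ?_
    obtain rfl := hmem.1 hv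
    exact ⟨w₁, w₂, hne, (hadj w₁).2 (Or.inl rfl), (hadj w₂).2 (Or.inr rfl), h⟩
  have b₁ := hd.card_add_le w₁
  have b₂ := hd.card_add_lt hne
  rw [hs, Finset.card_singleton, hV] at b₁ b₂
  rw [hs] at hd
  by_cases c₁ : d w₁ = c + 3
  · by_cases c₂ : d w₂ = c + 2
    · exact Or.inr (Or.inl (isIso_theta_zero (by omega) hd hadj hout (by omega) (by omega)))
    by_cases c₃ : d w₂ = c + 1
    · exact Or.inr (Or.inr (Or.inr (Or.inl
        (isIso_theta_zero (by omega) hd hadj hout (by omega) (by omega)))))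
    · exact Or.inr (Or.inr (Or.inr (Or.inr
        (fin' (pow_add_pow_lt_of_le' ht0 ht1 (by omega) (by omega))))))
  · by_cases c₂ : d w₂ = c + 2
    · exact Or.inr (Or.inr (Or.inl
        (isIso_theta_one_one hV hd hadj hne hout (by omega) c₂)))
    · exact Or.inr (Or.inr (Or.inr (Or.inr
        (fin' (pow_add_pow_lt_of_le ht0 ht1 (by omega) (by omega))))))

end Classification

lemma exists_digraph_fin {W : Type*} [Fintype W] {n : ℕ} (hW : Fintype.card W = n)
    {H : Digraph W} (h1 : IsSimple H) (h2 : IsStronglyConnected H) :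
    ∃ D : Digraph (Fin n), IsSimple D ∧ IsStronglyConnected D ∧ q D = q H := by
  let e := Fintype.equivFinOfCardEq hW
  have hiso : IsIso H (⟨fun i j => H.Adj (e.symm i) (e.symm j)⟩ : Digraph (Fin n)) :=
    ⟨⟨e, by simp⟩⟩
  exact ⟨_, hiso.isSimple h1, hiso.isStronglyConnected h2, hiso.q_eq.symm⟩

end StrongDigraph

/-! ### The four smallest spectral radii -/

open StrongDigraph in
theorem theorem5p4 (n : ℕ) (hn : 4 ≤ n) :
    StrongDigraph.IsUniqueKthMinimizer n 1 (StrongDigraph.directedCycle n) ∧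
    StrongDigraph.IsUniqueKthMinimizer n 2 (StrongDigraph.theta 0 1 (n - 3)) ∧
    StrongDigraph.IsUniqueKthMinimizer n 3 (StrongDigraph.theta 1 1 (n - 4)) ∧
    StrongDigraph.IsUniqueKthMinimizer n 4 (StrongDigraph.theta 0 2 (n - 4)) := by
  obtain ⟨c, rfl⟩ : ∃ c, n = c + 4 := ⟨n - 4, by omega⟩
  rw [show c + 4 - 3 = c + 1 by omega, show c + 4 - 4 = c by omega]
  obtain ⟨μ₂, g₂, r₂⟩ := exists_root (c + 3) (c + 2)
  obtain ⟨μ₃, g₃, r₃⟩ := exists_root (c + 2) (c + 2)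
  obtain ⟨μ₄, g₄, r₄⟩ := exists_root (c + 3) (c + 1)
  have inv0 {μ : ℝ} (h : 1 < μ) : 0 < μ⁻¹ := by positivity
  have inv1 {μ : ℝ} (h : 1 < μ) : μ⁻¹ < 1 := inv_lt_one_of_one_lt₀ h
  have lt₂₃ : μ₂ < μ₃ := root_lt_root g₃ r₂ r₃ (pow_add_pow_lt_two_mul (inv0 g₂) (inv1 g₂))
  have lt₃₄ : μ₃ < μ₄ := root_lt_root g₄ r₃ r₄ (two_mul_lt_pow_add_pow (inv0 g₃) (inv1 g₃))
  have q₁ : q (directedCycle (c + 4)) = 2 := q_eq_two_of_outDegree_eq_one outDegree_directedCycle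
  have q₂ : q (theta 0 1 (c + 1)) = 1 + μ₂ := by
    refine q_theta (by simp) (by linarith) ?_
    rw [r₂]
    congr 2 <;> omega
  have q₃ : q (theta 1 1 c) = 1 + μ₃ := by
    refine q_theta (by simp) (by linarith) ?_
    rw [r₃]
    congr 2 <;> omega
  have q₄ : q (theta 0 2 c) = 1 + μ₄ := by
    refine q_theta (by simp) (by linarith) ?_
    rw [r₄]
    congr 2 <;> omega
  have key (D : Digraph (Fin (c + 4))) (hD : IsStronglyConnected D) :
      (IsIso D (directedCycle (c + 4)) ∧ q D = 2) ∨
      (IsIso D (theta 0 1 (c + 1)) ∧ q D = 1 + μ₂) ∨ (IsIso D (theta 1 1 c) ∧ q D = 1 + μ₃) ∨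
      (IsIso D (theta 0 2 c) ∧ q D = 1 + μ₄) ∨ 1 + μ₄ < q D := by
    rcases isIso_or_lt_q (by simp) hD g₄ r₄ with h | h | h | h | h
    · exact Or.inl ⟨h, h.q_eq.trans q₁⟩
    · exact Or.inr (Or.inl ⟨h, h.q_eq.trans q₂⟩)
    · exact Or.inr (Or.inr (Or.inl ⟨h, h.q_eq.trans q₃⟩))
    · exact Or.inr (Or.inr (Or.inr (Or.inl ⟨h, h.q_eq.trans q₄⟩)))
    · exact Or.inr (Or.inr (Or.inr (Or.inr h)))
  have e₁ : ∃ D : Digraph (Fin (c + 4)), IsSimple D ∧ IsStronglyConnected D ∧ q D = 2 :=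
    ⟨_, isSimple_directedCycle (by omega), isStronglyConnected_directedCycle _, q₁⟩
  have e₂ : ∃ D : Digraph (Fin (c + 4)), IsSimple D ∧ IsStronglyConnected D ∧ q D = 1 + μ₂ :=
    q₂ ▸ exists_digraph_fin ((card_thetaVertex _ _ _).trans (by omega)) isSimple_theta
      (isStronglyConnected_theta _ _ _)
  have e₃ : ∃ D : Digraph (Fin (c + 4)), IsSimple D ∧ IsStronglyConnected D ∧ q D = 1 + μ₃ :=
    q₃ ▸ exists_digraph_fin ((card_thetaVertex _ _ _).trans (by omega)) isSimple_theta
      (isStronglyConnected_theta _ _ _)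
  refine ⟨⟨by simp, isSimple_directedCycle (by omega), isStronglyConnected_directedCycle _, ?_, ?_⟩,
    ⟨(card_thetaVertex _ _ _).trans (by omega), isSimple_theta, isStronglyConnected_theta _ _ _,
      ?_, ?_⟩,
    ⟨(card_thetaVertex _ _ _).trans (by omega), isSimple_theta, isStronglyConnected_theta _ _ _,
      ?_, ?_⟩,
    ⟨(card_thetaVertex _ _ _).trans (by omega), isSimple_theta, isStronglyConnected_theta _ _ _,
      ?_, ?_⟩⟩
  · rw [q₁]
    have : {x : ℝ | x < 2 ∧ ∃ D : Digraph (Fin (c + 4)),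
        IsSimple D ∧ IsStronglyConnected D ∧ q D = x} = ∅ := by
      rw [Set.eq_empty_iff_forall_notMem]
      rintro x ⟨hx, D, -, hD, rfl⟩
      rcases key D hD with ⟨-, h⟩ | ⟨-, h⟩ | ⟨-, h⟩ | ⟨-, h⟩ | h <;> linarith
    rw [this]
    simp
  · intro D _ hD hq
    rw [q₁] at hq
    rcases key D hD with ⟨h, -⟩ | ⟨-, h⟩ | ⟨-, h⟩ | ⟨-, h⟩ | h
    · exact h
    all_goals linarith
  · rw [q₂]
    have : {x : ℝ | x < 1 + μ₂ ∧ ∃ D : Digraph (Fin (c + 4)),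
        IsSimple D ∧ IsStronglyConnected D ∧ q D = x} = {2} := by
      ext x
      constructor
      · rintro ⟨hx, D, -, hD, rfl⟩
        rcases key D hD with ⟨-, h⟩ | ⟨-, h⟩ | ⟨-, h⟩ | ⟨-, h⟩ | h
        · exact h
        all_goals linarith
      · rintro rfl
        exact ⟨by linarith, e₁⟩
    rw [this, Set.encard_singleton]
    norm_num
  · intro D _ hD hq
    rw [q₂] at hq
    rcases key D hD with ⟨-, h⟩ | ⟨h, -⟩ | ⟨-, h⟩ | ⟨-, h⟩ | h
    · linarith
    · exact h
    all_goals linarith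
  · rw [q₃]
    have : {x : ℝ | x < 1 + μ₃ ∧ ∃ D : Digraph (Fin (c + 4)),
        IsSimple D ∧ IsStronglyConnected D ∧ q D = x} = {2, 1 + μ₂} := by
      ext x
      constructor
      · rintro ⟨hx, D, -, hD, rfl⟩
        rcases key D hD with ⟨-, h⟩ | ⟨-, h⟩ | ⟨-, h⟩ | ⟨-, h⟩ | h
        · exact Or.inl h
        · exact Or.inr h
        all_goals linarith
      · rintro (rfl | rfl)
        · exact ⟨by linarith, e₁⟩
        · exact ⟨by linarith, e₂⟩
    rw [this, Set.encard_pair (by linarith)]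
    norm_num
  · intro D _ hD hq
    rw [q₃] at hq
    rcases key D hD with ⟨-, h⟩ | ⟨-, h⟩ | ⟨h, -⟩ | ⟨-, h⟩ | h
    · linarith
    · linarith
    · exact h
    all_goals linarith
  · rw [q₄]
    have : {x : ℝ | x < 1 + μ₄ ∧ ∃ D : Digraph (Fin (c + 4)),
        IsSimple D ∧ IsStronglyConnected D ∧ q D = x} = {2, 1 + μ₂, 1 + μ₃} := by
      ext x
      constructor
      · rintro ⟨hx, D, -, hD, rfl⟩
        rcases key D hD with ⟨-, h⟩ | ⟨-, h⟩ | ⟨-, h⟩ | ⟨-, h⟩ | h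
        · exact Or.inl h
        · exact Or.inr (Or.inl h)
        · exact Or.inr (Or.inr h)
        all_goals linarith
      · rintro (rfl | rfl | rfl)
        · exact ⟨by linarith, e₁⟩
        · exact ⟨by linarith, e₂⟩
        · exact ⟨by linarith, e₃⟩
    rw [this, Set.encard_eq_three.2 ⟨2, 1 + μ₂, 1 + μ₃, ne_of_lt (by linarith),
      ne_of_lt (by linarith), ne_of_lt (by linarith), rfl⟩]
    norm_num
  · intro D _ hD hq
    rw [q₄] at hq
    rcases key D hD with ⟨-, h⟩ | ⟨-, h⟩ | ⟨-, h⟩ | ⟨h, -⟩ | h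
    · linarith
    · linarith
    · linarith
    · exact h
    · linarith
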